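/- Let $K$ be an algebraically closed field of characteristic $0$, let $n\ge 2$, and let $C$ be the dual coalgebra of $K[y]/(y^n)$, with basis $x_0,\dots,x_{n-1}$ dual to $1,y,\dots,y^{n-1}$, so that $\Delta(x_i)=\sum_{j+k=i}x_j\otimes x_k$ and $\epsilon(x_i)=\delta_{i0}$. A pair $(C,\mathfrak p)$, where $\mathfrak p\colon C\otimes C\to C$ is a coalgebra morphism written $a\cdot b:=\mathfrak p(a\otimes b)$, is a *cycle coalgebra* if $(C,\mathfrak p,\mathfrak p)$ is a (regular) $q$-cycle coalgebra, that is: 1. there are coalgebra morphisms $a\otimes b\mapsto a^b$ and $a\otimes b\mapsto a_b$ from $C\otimes C$ to $C$ such that, for all $a,b\in C$, $$a^{b_{(1)}}\cdot b_{(2)}=(a\cdot b_{(1)})^{b_{(2)}}=\epsilon(b)a\quad\text{and}\quad (a\cdot b_{(2)})_{b_{(1)}}=a_{b_{(2)}}\cdot b_{(1)}=\epsilon(b)a;$$ 2. $(a\cdot b_{(1)})\cdot(c\cdot b_{(2)})=(a\cdot c_{(2)})\cdot(b\cdot c_{(1)})$ for all $a,b,c\in C$. Write $\mathfrak p(x_i\otimes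 x_j)=\sum_k\mathfrak p_{ij}^k x_k$. Let $1\le v_0<n$ and let $p_v\in K$ $(v_0\le v<n)$ be arbitrary with $p_{v_0}=1$. Then there is a cycle coalgebra $(C,\mathfrak p)$ such that $$\mathfrak p_{1v}^1=\delta_{0v}\ \text{ for } 0\le v<v_0\qquad\text{and}\qquad \mathfrak p_{1v}^1=p_v\ \text{ for } v_0\le v<n.$$ More precisely, such a cycle coalgebra is the *standard cycle coalgebra* $\mathrm{SCC}(f)$ associated with $f:=1+\sum_{v=v_0}^{n-1}p_vx^v$, whose operation is the unique coalgebra morphism $\mathfrak p\colon C\otimes C\to C$ with the following coefficients $\mathfrak p_{uv}^w$ for $0\le u,v,w<n$. Let $g\in K[[x]]$ be the series with $g f'=f(f^{v_0}-1)$, and let $G=\sum_{v\ge0}g_v(x)y^v\in K[[x]][[y]]$ be the series with $g_0(x)=x$ and $$G_y(x,y)=g(x)f'(y)G_x(x,y)-(f(y)-1)G_y(x,y).$$ Then $\mathfrak p_{uv}^0=\delta_{0,u+v}$, the elements $\mathfrak p_{uv}^1$ are given by $G(x,y)=\sum_{u,v}\mathfrak p_{uv}^1x^uy^v$, and $$\mathfrak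 p_{uv}^w=\sum_{\substack{u_1+u_2=u\\ v_1+v_2=v}}\mathfrak p_{u_1v_1}^1\,\mathfrak p_{u_2v_2}^{w-1}\quad\text{for } w>1.$$ -/

import Mathlib

open scoped TensorProduct

noncomputable section

set_option linter.unusedSectionVars false

namespace DualCoalgebra

variable {K A : Type*} [CommRing K] [Ring A] [Algebra K A] [Module.Finite K A] [Module.Free K A]

/-- The comultiplication of the dual coalgebra of a finite free algebra `A`: the transpose
`A* → (A ⊗ A)*` of the multiplication, followed by the inverse of the canonical isomorphism
`A* ⊗ A* ≃ (A ⊗ A)*`. -/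
def comul : Module.Dual K A →ₗ[K] Module.Dual K A ⊗[K] Module.Dual K A :=
  (TensorProduct.dualDistribEquiv K A A).symm.toLinearMap ∘ₗ (LinearMap.mul' K A).dualMap

/-- The counit of the dual coalgebra: evaluation at `1`. -/
def counit : Module.Dual K A →ₗ[K] K := Module.Dual.eval K A 1

theorem dualDistrib_comul (φ : Module.Dual K A) (a b : A) :
    TensorProduct.dualDistrib K A A (comul φ) (a ⊗ₜ b) = φ (a * b) := by
  have h : TensorProduct.dualDistribEquiv K A A (comul φ) = (LinearMap.mul' K A).dualMap φ :=
    (TensorProduct.dualDistribEquiv K A A).apply_symm_apply _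
  have h2 : TensorProduct.dualDistrib K A A (comul φ)
      = TensorProduct.dualDistribEquiv K A A (comul φ) := rfl
  rw [h2, h]
  simp

theorem dualDistrib_injective : Function.Injective (TensorProduct.dualDistrib K A A) :=
  (TensorProduct.dualDistribEquiv K A A).injective

/-- Evaluation of an element of `A* ⊗ (A* ⊗ A*)` on `A ⊗ (A ⊗ A)`. -/
def triple : Module.Dual K A ⊗[K] (Module.Dual K A ⊗[K] Module.Dual K A) ≃ₗ[K]
    Module.Dual K (A ⊗[K] (A ⊗[K] A)) :=
  (TensorProduct.congr (LinearEquiv.refl K _) (TensorProduct.dualDistribEquiv K A A)).trans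
    (TensorProduct.dualDistribEquiv K A (A ⊗[K] A))

theorem triple_tmul (φ : Module.Dual K A) (t : Module.Dual K A ⊗[K] Module.Dual K A) (a b c : A) :
    triple (φ ⊗ₜ t) (a ⊗ₜ (b ⊗ₜ c)) = φ a * TensorProduct.dualDistrib K A A t (b ⊗ₜ c) := rfl

theorem triple_lTensor (t : Module.Dual K A ⊗[K] Module.Dual K A) (a b c : A) :
    triple (comul.lTensor _ t) (a ⊗ₜ (b ⊗ₜ c))
      = TensorProduct.dualDistrib K A A t (a ⊗ₜ (b * c)) := by
  induction t with
  | zero => simp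
  | add x y hx hy => simp only [map_add, LinearMap.add_apply, hx, hy]
  | tmul φ ψ => simp [triple_tmul, dualDistrib_comul]

theorem triple_assoc (t : Module.Dual K A ⊗[K] Module.Dual K A) (ψ : Module.Dual K A) (a b c : A) :
    triple (TensorProduct.assoc K _ _ _ (t ⊗ₜ ψ)) (a ⊗ₜ (b ⊗ₜ c))
      = TensorProduct.dualDistrib K A A t (a ⊗ₜ b) * ψ c := by
  induction t with
  | zero => simp
  | add x y hx hy => simp only [TensorProduct.add_tmul, map_add, LinearMap.add_apply, hx, hy, add_mul]
  | tmul φ χ => simp [triple_tmul, mul_assoc]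

theorem triple_rTensor (t : Module.Dual K A ⊗[K] Module.Dual K A) (a b c : A) :
    triple (TensorProduct.assoc K _ _ _ (comul.rTensor _ t)) (a ⊗ₜ (b ⊗ₜ c))
      = TensorProduct.dualDistrib K A A t ((a * b) ⊗ₜ c) := by
  induction t with
  | zero => simp
  | add x y hx hy => simp only [map_add, LinearMap.add_apply, hx, hy]
  | tmul φ ψ => simp [triple_assoc, dualDistrib_comul]

theorem rTensor_counit (t : Module.Dual K A ⊗[K] Module.Dual K A) (a : A) :
    TensorProduct.lid K _ (counit.rTensor _ t) a
      = TensorProduct.dualDistrib K A A t (1 ⊗ₜ a) := by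
  induction t with
  | zero => simp
  | add x y hx hy => simp only [map_add, LinearMap.add_apply, hx, hy]
  | tmul φ ψ => simp [counit]

theorem lTensor_counit (t : Module.Dual K A ⊗[K] Module.Dual K A) (a : A) :
    TensorProduct.rid K _ (counit.lTensor _ t) a
      = TensorProduct.dualDistrib K A A t (a ⊗ₜ 1) := by
  induction t with
  | zero => simp
  | add x y hx hy => simp only [map_add, LinearMap.add_apply, hx, hy]
  | tmul φ ψ => simp [counit, mul_comm]

/-- The dual coalgebra of an algebra which is finite and free as a module. -/
instance instCoalgebra : Coalgebra K (Module.Dual K A) where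
  comul := comul
  counit := counit
  coassoc := by
    refine LinearMap.ext fun φ => triple.injective (TensorProduct.ext_threefold' fun a b c => ?_)
    simp [triple_lTensor, triple_rTensor, dualDistrib_comul, mul_assoc]
  rTensor_counit_comp_comul := by
    refine LinearMap.ext fun φ => (TensorProduct.lid K _).injective (LinearMap.ext fun a => ?_)
    simp [rTensor_counit, dualDistrib_comul]
  lTensor_counit_comp_comul := by
    refine LinearMap.ext fun φ => (TensorProduct.rid K _).injective (LinearMap.ext fun a => ?_)
    simp [lTensor_counit, dualDistrib_comul]

end DualCoalgebra

section CycleCoalgebras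

variable {K C : Type*} [CommRing K] [AddCommGroup C] [Module K C] [Coalgebra K C]

/-- The left translation `b ↦ m (a ⊗ b)` of a binary operation `m : C ⊗ C → C`. -/
def leftTr (m : C ⊗[K] C →ₗc[K] C) (a : C) : C →ₗ[K] C :=
  (m : C ⊗[K] C →ₗ[K] C) ∘ₗ TensorProduct.mk K C C a

/-- The flipped comultiplication `b ↦ b₍₂₎ ⊗ b₍₁₎`. -/
def comulOp : C →ₗ[K] C ⊗[K] C :=
  (TensorProduct.comm K C C).toLinearMap ∘ₗ Coalgebra.comul

/-- A regular `q`-magma coalgebra `(C, 𝔭, 𝔡)`. Writing `a · b = 𝔭 (a ⊗ b)` and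
`a : b = 𝔡 (a ⊗ b)`, there are coalgebra morphisms `r : a ⊗ b ↦ a^b` and `s : a ⊗ b ↦ a_b` with
`a^(b₍₁₎) · b₍₂₎ = (a · b₍₁₎)^(b₍₂₎) = ε(b) a` and
`(a : b₍₂₎)_(b₍₁₎) = a_(b₍₂₎) : b₍₁₎ = ε(b) a` for all `a, b`. -/
def IsRegularQMagmaCoalgebra (𝔭 𝔡 : C ⊗[K] C →ₗc[K] C) : Prop :=
  ∃ r s : C ⊗[K] C →ₗc[K] C, ∀ a b : C,
    𝔭 (TensorProduct.map (leftTr r a) LinearMap.id (Coalgebra.comul (R := K) b))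
      = Coalgebra.counit (R := K) b • a ∧
    r (TensorProduct.map (leftTr 𝔭 a) LinearMap.id (Coalgebra.comul (R := K) b))
      = Coalgebra.counit (R := K) b • a ∧
    s (TensorProduct.map (leftTr 𝔡 a) LinearMap.id (comulOp (K := K) b))
      = Coalgebra.counit (R := K) b • a ∧
    𝔡 (TensorProduct.map (leftTr s a) LinearMap.id (comulOp (K := K) b))
      = Coalgebra.counit (R := K) b • a

/-- A `q`-cycle coalgebra `(C, 𝔭, 𝔡)`, where `a · b = 𝔭 (a ⊗ b)` and `a : b = 𝔡 (a ⊗ b)`. -/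
structure IsQCycleCoalgebra (𝔭 𝔡 : C ⊗[K] C →ₗc[K] C) : Prop where
  regular : IsRegularQMagmaCoalgebra 𝔭 𝔡
  /-- `(a · b₍₁₎) · (c : b₍₂₎) = (a · c₍₂₎) · (b · c₍₁₎)` -/
  cond1 : ∀ a b c : C,
    𝔭 (TensorProduct.map (leftTr 𝔭 a) (leftTr 𝔡 c) (Coalgebra.comul (R := K) b))
      = 𝔭 (TensorProduct.map (leftTr 𝔭 a) (leftTr 𝔭 b) (comulOp (K := K) c))
  /-- `(a · b₍₁₎) : (c · b₍₂₎) = (a : c₍₂₎) · (b : c₍₁₎)` -/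
  cond2 : ∀ a b c : C,
    𝔡 (TensorProduct.map (leftTr 𝔭 a) (leftTr 𝔭 c) (Coalgebra.comul (R := K) b))
      = 𝔭 (TensorProduct.map (leftTr 𝔡 a) (leftTr 𝔡 b) (comulOp (K := K) c))
  /-- `(a : b₍₁₎) : (c : b₍₂₎) = (a : c₍₂₎) : (b · c₍₁₎)` -/
  cond3 : ∀ a b c : C,
    𝔡 (TensorProduct.map (leftTr 𝔡 a) (leftTr 𝔡 c) (Coalgebra.comul (R := K) b))
      = 𝔡 (TensorProduct.map (leftTr 𝔡 a) (leftTr 𝔭 b) (comulOp (K := K) c))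

/-- `(C, 𝔭)` is a cycle coalgebra when `(C, 𝔭, 𝔭)` is a `q`-cycle coalgebra. -/
def IsCycleCoalgebra (𝔭 : C ⊗[K] C →ₗc[K] C) : Prop := IsQCycleCoalgebra 𝔭 𝔭

end CycleCoalgebras

section Truncated

variable (K : Type*) [Field K] (n : ℕ)

/-- The truncated polynomial algebra `K[y]/(yⁿ)`. -/
abbrev TruncAlg : Type _ := AdjoinRoot ((Polynomial.X : Polynomial K) ^ n)

instance TruncAlg.instFinite : Module.Finite K (TruncAlg K n) :=
  (Polynomial.monic_X_pow n).finite_adjoinRoot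

/-- The dual coalgebra `C` of `K[y]/(yⁿ)`. -/
abbrev TruncDual : Type _ := Module.Dual K (TruncAlg K n)

/-- The basis `1, y, …, yⁿ⁻¹` of `K[y]/(yⁿ)`. -/
def TruncAlg.basis : Module.Basis (Fin n) K (TruncAlg K n) :=
  (AdjoinRoot.powerBasis' (Polynomial.monic_X_pow (R := K) n)).basis.reindex
    (finCongr (Polynomial.natDegree_X_pow n))

theorem TruncAlg.basis_apply (i : Fin n) :
    TruncAlg.basis K n i = AdjoinRoot.root ((Polynomial.X : Polynomial K) ^ n) ^ (i : ℕ) := by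
  rw [TruncAlg.basis, Module.Basis.reindex_apply, PowerBasis.basis_eq_pow]
  rfl

/-- The basis `x₀, …, xₙ₋₁` of `C` dual to `1, y, …, yⁿ⁻¹`. -/
def TruncDual.basis : Module.Basis (Fin n) K (TruncDual K n) := (TruncAlg.basis K n).dualBasis

variable {K n}

/-- The coefficient `𝔭ᵢⱼᵏ` in `𝔭 (xᵢ ⊗ xⱼ) = ∑ₖ 𝔭ᵢⱼᵏ xₖ`. -/
def structCoeff (𝔭 : TruncDual K n ⊗[K] TruncDual K n →ₗc[K] TruncDual K n) (i j k : Fin n) : K :=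
  (TruncDual.basis K n).repr (𝔭 (TruncDual.basis K n i ⊗ₜ TruncDual.basis K n j)) k

end Truncated

section Standard

open PowerSeries

variable {K : Type*} [Field K]

/-- The series `f = 1 + ∑_{v₀ ≤ v < n} p_v x^v`. -/
def sccSeries (n v₀ : ℕ) (p : ℕ → K) : K⟦X⟧ :=
  1 + ∑ v ∈ Finset.Ico v₀ n, PowerSeries.C (p v) * (PowerSeries.X : K⟦X⟧) ^ v

/-- The defining equations of the series `g ∈ K[[x]]` and `G = ∑_v g_v(x) y^v ∈ K[[x]][[y]]`
attached to `f`: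
`g f' = f (f^v₀ - 1)`, `g₀ = x`, `G_y(x,y) = g(x) f'(y) G_x(x,y) - (f(y) - 1) G_y(x,y)`. -/
structure IsSCCPair (v₀ : ℕ) (f g : K⟦X⟧) (G : K⟦X⟧⟦X⟧) : Prop where
  g_eq : g * derivative K f = f * (f ^ v₀ - 1)
  G_zero : coeff 0 G = (PowerSeries.X : K⟦X⟧)
  G_eq : derivative K⟦X⟧ G =
    PowerSeries.C g * PowerSeries.map (PowerSeries.C (R := K)) (derivative K f) *
        PowerSeries.mk (fun v => derivative K (coeff v G))
      - PowerSeries.map (PowerSeries.C (R := K)) (f - 1) * derivative K⟦X⟧ G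

/-- The family `sccCoeff G w u v = 𝔭ᵤᵥʷ` built from `G = ∑ 𝔭ᵤᵥ¹ x^u y^v`: one has
`𝔭ᵤᵥ⁰ = δ_{0,u+v}` and, for `w > 1`,
`𝔭ᵤᵥʷ = ∑_{u₁+u₂=u, v₁+v₂=v} 𝔭_{u₁v₁}¹ 𝔭_{u₂v₂}^{w-1}`. -/
def sccCoeff (G : K⟦X⟧⟦X⟧) : ℕ → ℕ → ℕ → K
  | 0, u, v => if u + v = 0 then 1 else 0
  | 1, u, v => coeff u (coeff v G)
  | w + 2, u, v => ∑ a ∈ Finset.HasAntidiagonal.antidiagonal u, ∑ b ∈ Finset.HasAntidiagonal.antidiagonal v,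
      coeff a.1 (coeff b.1 G) * sccCoeff G (w + 1) a.2 b.2

/-- `𝔭` is the operation of the standard cycle coalgebra `SCC(f)` of degree `v₀`: its
coefficients are those built from the series `G` attached to `f`. -/
def IsSCC {n : ℕ} (v₀ : ℕ) (f : K⟦X⟧)
    (𝔭 : TruncDual K n ⊗[K] TruncDual K n →ₗc[K] TruncDual K n) : Prop :=
  ∃ (g : K⟦X⟧) (G : K⟦X⟧⟦X⟧), IsSCCPair v₀ f g G ∧
    ∀ i j k : Fin n, structCoeff 𝔭 i j k = sccCoeff G k i j

end Standard

end

/-! Dualise. With `A = K[y]/(yⁿ)`, an algebra morphism `Δ : A → A ⊗ A` transposes to an operation on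
`C`. Since `A` is commutative, `C` is cocommutative, and the axioms become identities between
algebra morphisms (`isCycleCoalgebra_op`). Here `Δ(y)` is the truncation of `G(x,y)`.

Write `m = v₀`. The equation for `G` says `f(y) G_y = f'(y) g(x) G_x`, so `G` is the flow of the
vector field `g d/dx` at time `log f(y)`. This field is `x γ d/dx` with `γ(0) = 1`, hence has a
coordinate `θ = x + ⋯` with `g θ' = θ`, and the flow is linear in it: `Δ(θ) = θ ⊗ φ`, where `φ` is
the class of `f`. Replacing `f` by `f⁻¹` gives the inverse operation.

On `θ` the cycle identity says that `(1 ⊗ φ) Δ(φ)` is symmetric. This is where `g f' = f (f^m - 1)`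
enters: `1 - f^(-m)` is an eigenvector of `g d/dx` with eigenvalue `m`, so `f^(-m) = 1 - m θ^m`
(`exists_linearisation`). Therefore `((1 ⊗ φ) Δ(φ))^(-m) = 1 - m (θ ⊗ 1)^m - m (1 ⊗ θ)^m`, which is
symmetric, and unipotent `m`-th roots are unique in characteristic `0`.

Finally `G ≡ x f(y)` modulo `x²` yields the prescribed `𝔭₁ᵥ¹`, and uniqueness of the flow yields
uniqueness of the operation. -/

noncomputable section

/-! ### Duality between operations on `A*` and algebra morphisms `A → A ⊗ A`. -/

namespace DualCoalgebra

variable {K A : Type*} [CommRing K] [CommRing A] [Algebra K A] [Module.Finite K A]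
  [Module.Free K A]

open TensorProduct Module

/-- The linear map `A* ⊗ A* → A*` dual to an algebra morphism `A → A ⊗ A`. -/
def opLin (Δ : A →ₐ[K] A ⊗[K] A) : Dual K A ⊗[K] Dual K A →ₗ[K] Dual K A :=
  Δ.toLinearMap.dualMap ∘ₗ dualDistrib K A A

omit [Module.Finite K A] [Module.Free K A] in
theorem opLin_apply (Δ : A →ₐ[K] A ⊗[K] A) (t : Dual K A ⊗[K] Dual K A) (z : A) :
    opLin Δ t z = dualDistrib K A A t (Δ z) := rfl

/-- Compatibility with comultiplication is the transpose of multiplicativity of `Δ`. The step `key`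
says that the middle interchange is its own transpose under the pairing. -/
theorem dualDistrib_map_opLin (Δ : A →ₐ[K] A ⊗[K] A) (φ ψ : Dual K A) (a b : A) :
    dualDistrib K A A (TensorProduct.map (opLin Δ) (opLin Δ)
      (tensorTensorTensorComm K _ _ _ _ (comul φ ⊗ₜ comul ψ))) (a ⊗ₜ b)
      = dualDistrib K A A (φ ⊗ₜ ψ) (Δ a * Δ b) := by
  have key : ∀ (u v : A ⊗[K] A) (t s : Dual K A ⊗[K] Dual K A),
      dualDistrib K _ _ (TensorProduct.map (dualDistrib K A A) (dualDistrib K A A)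
        (tensorTensorTensorComm K _ _ _ _ (t ⊗ₜ s))) (u ⊗ₜ v)
      = dualDistrib K _ _ (TensorProduct.map (dualDistrib K A A) (dualDistrib K A A) (t ⊗ₜ s))
          (tensorTensorTensorComm K _ _ _ _ (u ⊗ₜ v)) := by
    intro u v t s
    induction u with
    | zero => simp
    | add x y hx hy => simp only [TensorProduct.add_tmul, map_add, hx, hy]
    | tmul a₁ a₂ =>
    induction v with
    | zero => simp
    | add x y hx hy => simp only [TensorProduct.tmul_add, map_add, hx, hy]
    | tmul b₁ b₂ =>
    induction t with
    | zero => simp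
    | add x y hx hy => simp only [TensorProduct.add_tmul, map_add, hx, hy, LinearMap.add_apply]
    | tmul φ₁ φ₂ =>
    induction s with
    | zero => simp
    | add x y hx hy => simp only [TensorProduct.tmul_add, map_add, hx, hy, LinearMap.add_apply]
    | tmul ψ₁ ψ₂ =>
      simp
      ring
  have h1 : ∀ w : (Dual K A ⊗[K] Dual K A) ⊗[K] (Dual K A ⊗[K] Dual K A),
      dualDistrib K A A (TensorProduct.map (opLin Δ) (opLin Δ) w) (a ⊗ₜ b)
      = dualDistrib K _ _ (TensorProduct.map (dualDistrib K A A) (dualDistrib K A A) w)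
          (Δ a ⊗ₜ Δ b) := by
    intro w
    induction w with
    | zero => simp
    | add x y hx hy => simp only [map_add, hx, hy, LinearMap.add_apply]
    | tmul t s => simp [opLin_apply]
  have h2 : ∀ u v : A ⊗[K] A,
      dualDistrib K _ _ (TensorProduct.map (dualDistrib K A A) (dualDistrib K A A)
          (comul φ ⊗ₜ comul ψ)) (tensorTensorTensorComm K _ _ _ _ (u ⊗ₜ v))
      = dualDistrib K A A (φ ⊗ₜ ψ) (u * v) := by
    intro u v
    induction u with
    | zero => simp
    | add x y hx hy => simp only [TensorProduct.add_tmul, map_add, hx, hy, add_mul]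
    | tmul a₁ a₂ =>
    induction v with
    | zero => simp
    | add x y hx hy => simp only [TensorProduct.tmul_add, map_add, hx, hy, mul_add]
    | tmul b₁ b₂ => simp [dualDistrib_comul]
  rw [h1, key, h2]

/-- The coalgebra morphism `A* ⊗ A* → A*` dual to an algebra morphism `A → A ⊗ A`. -/
def op (Δ : A →ₐ[K] A ⊗[K] A) : Dual K A ⊗[K] Dual K A →ₗc[K] Dual K A where
  __ := opLin Δ
  counit_comp := by
    refine TensorProduct.ext' fun φ ψ => ?_
    change opLin Δ (φ ⊗ₜ ψ) 1 = _
    rw [opLin_apply, map_one, Algebra.TensorProduct.one_def, dualDistrib_apply,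
      TensorProduct.counit_tmul]
    simp [Coalgebra.counit, counit, mul_comm]
  map_comp_comul := by
    refine TensorProduct.ext' fun φ ψ => dualDistrib_injective (TensorProduct.ext' fun a b => ?_)
    change dualDistrib K A A (TensorProduct.map (opLin Δ) (opLin Δ)
      (Coalgebra.comul (R := K) (φ ⊗ₜ[K] ψ))) (a ⊗ₜ b)
      = dualDistrib K A A (comul (opLin Δ (φ ⊗ₜ ψ))) (a ⊗ₜ b)
    rw [dualDistrib_comul, opLin_apply, map_mul, TensorProduct.comul_tmul]
    exact dualDistrib_map_opLin Δ φ ψ a b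

theorem op_apply (Δ : A →ₐ[K] A ⊗[K] A) (t : Dual K A ⊗[K] Dual K A) (z : A) :
    op Δ t z = dualDistrib K A A t (Δ z) := rfl

theorem leftTr_op_apply (Δ : A →ₐ[K] A ⊗[K] A) (φ ψ : Dual K A) (z : A) :
    leftTr (op Δ) φ ψ z = dualDistrib K A A (φ ⊗ₜ ψ) (Δ z) := rfl

/-- Cocommutativity of `A*`, dual to commutativity of `A`; it makes the two halves of the regularity
axiom the same. -/
theorem comulOp_eq_comul (φ : Dual K A) : comulOp (K := K) φ = comul φ := by
  refine dualDistrib_injective (TensorProduct.ext' fun a b => ?_)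
  have h : ∀ t : Dual K A ⊗[K] Dual K A,
      dualDistrib K A A (TensorProduct.comm K _ _ t) (a ⊗ₜ b)
        = dualDistrib K A A t (b ⊗ₜ a) := by
    intro t
    induction t with
    | zero => simp
    | add x y hx hy => simp only [map_add, LinearMap.add_apply, hx, hy]
    | tmul φ ψ => simp [mul_comm]
  change dualDistrib K A A (TensorProduct.comm K _ _ (comul φ)) (a ⊗ₜ b) = _
  rw [h, dualDistrib_comul, dualDistrib_comul, mul_comm]

/-- The endomorphism `a ⊗ b ↦ Δ(a) (1 ⊗ b)` of `A ⊗ A`. -/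
def extendRight (Δ : A →ₐ[K] A ⊗[K] A) : A ⊗[K] A →ₐ[K] A ⊗[K] A :=
  Algebra.TensorProduct.lift Δ Algebra.TensorProduct.includeRight fun _ _ => Commute.all _ _

theorem dualDistrib_leftTr_id (Δ : A →ₐ[K] A ⊗[K] A) (φ ψ : Dual K A) (u : A ⊗[K] A) :
    dualDistrib K A A (TensorProduct.map (leftTr (op Δ) φ) LinearMap.id (comul ψ)) u
      = dualDistrib K A A (φ ⊗ₜ ψ) (extendRight Δ u) := by
  have h2 : ∀ (t : Dual K A ⊗[K] Dual K A) (a b : A),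
      dualDistrib K A A (TensorProduct.map (leftTr (op Δ) φ) LinearMap.id t) (a ⊗ₜ b)
      = (LinearMap.mul' K K ∘ₗ TensorProduct.map φ (dualDistrib K A A t))
          (TensorProduct.assoc K A A A (Δ a ⊗ₜ b)) := by
    intro t a b
    induction t with
    | zero => simp
    | add x y hx hy =>
      simp only [map_add, LinearMap.add_apply, hx, hy, LinearMap.comp_apply,
        TensorProduct.map_add_right]
    | tmul φ₁ φ₂ =>
      simp only [TensorProduct.map_tmul, dualDistrib_apply, leftTr_op_apply, LinearMap.id_apply]
      generalize Δ a = w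
      induction w with
      | zero => simp
      | add x y hx hy => simp only [map_add, add_mul, TensorProduct.add_tmul, hx, hy]
      | tmul p q => simp [mul_assoc]
  induction u with
  | zero => simp
  | add x y hx hy => simp only [map_add, hx, hy]
  | tmul a b =>
    rw [h2, extendRight, Algebra.TensorProduct.lift_tmul]
    generalize Δ a = w
    induction w with
    | zero => simp
    | add x y hx hy => simp only [map_add, TensorProduct.add_tmul, hx, hy, add_mul]
    | tmul p q => simp [dualDistrib_comul]

/-- The algebra morphism `A ⊗ A → A ⊗ (A ⊗ A)` onto the first and second factors. -/
def incl12 : A ⊗[K] A →ₐ[K] A ⊗[K] (A ⊗[K] A) :=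
  Algebra.TensorProduct.map (AlgHom.id K A) Algebra.TensorProduct.includeLeft

/-- The algebra morphism `A ⊗ A → A ⊗ (A ⊗ A)` onto the first and third factors. -/
def incl13 : A ⊗[K] A →ₐ[K] A ⊗[K] (A ⊗[K] A) :=
  Algebra.TensorProduct.map (AlgHom.id K A) Algebra.TensorProduct.includeRight

/-- The algebra morphism `A ⊗ A → A ⊗ (A ⊗ A)` onto the second and third factors. -/
def incl23 : A ⊗[K] A →ₐ[K] A ⊗[K] (A ⊗[K] A) :=
  Algebra.TensorProduct.includeRight

/-- The algebra morphism `A ⊗ A → A ⊗ (A ⊗ A)` onto the third and second factors. -/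
def incl32 : A ⊗[K] A →ₐ[K] A ⊗[K] (A ⊗[K] A) :=
  incl23.comp (Algebra.TensorProduct.comm K A A).toAlgHom

/-- The algebra morphism `a ⊗ c ↦ Δ(a)₁₂ Δ(c)₃₂`. -/
def cycleLeft (Δ : A →ₐ[K] A ⊗[K] A) : A ⊗[K] A →ₐ[K] A ⊗[K] (A ⊗[K] A) :=
  Algebra.TensorProduct.lift (incl12.comp Δ) (incl32.comp Δ) fun _ _ => Commute.all _ _

/-- The algebra morphism `a ⊗ b ↦ Δ(a)₁₃ Δ(b)₂₃`. -/
def cycleRight (Δ : A →ₐ[K] A ⊗[K] A) : A ⊗[K] A →ₐ[K] A ⊗[K] (A ⊗[K] A) :=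
  Algebra.TensorProduct.lift (incl13.comp Δ) (incl23.comp Δ) fun _ _ => Commute.all _ _

theorem dualDistrib_leftTr_leftTr (Δ : A →ₐ[K] A ⊗[K] A) (φ χ : Dual K A)
    (t : Dual K A ⊗[K] Dual K A) (a c : A) :
    dualDistrib K A A (TensorProduct.map (leftTr (op Δ) φ) (leftTr (op Δ) χ) t) (a ⊗ₜ c)
      = dualDistrib K _ _ (dualDistrib K A A (φ ⊗ₜ χ) ⊗ₜ dualDistrib K A A t)
          (tensorTensorTensorComm K A A A A (Δ a ⊗ₜ Δ c)) := by
  induction t with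
  | zero => simp
  | add x y hx hy =>
    simp only [map_add, LinearMap.add_apply, hx, hy, TensorProduct.tmul_add]
  | tmul ψ₁ ψ₂ =>
    simp only [TensorProduct.map_tmul, dualDistrib_apply, leftTr_op_apply]
    generalize Δ a = u
    generalize Δ c = v
    induction u with
    | zero => simp
    | add x y hx hy => simp only [map_add, add_mul, TensorProduct.add_tmul, hx, hy]
    | tmul p q =>
    induction v with
    | zero => simp
    | add x y hx hy => simp only [map_add, mul_add, TensorProduct.tmul_add, hx, hy]
    | tmul r s =>
      simp
      ring

theorem dualDistrib_cycleLeft (Δ : A →ₐ[K] A ⊗[K] A) (φ ψ χ : Dual K A) (u : A ⊗[K] A) :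
    dualDistrib K A A (TensorProduct.map (leftTr (op Δ) φ) (leftTr (op Δ) χ) (comul ψ)) u
      = triple (φ ⊗ₜ (ψ ⊗ₜ χ)) (cycleLeft Δ u) := by
  induction u with
  | zero => simp
  | add x y hx hy => simp only [map_add, hx, hy]
  | tmul a c =>
    rw [dualDistrib_leftTr_leftTr, cycleLeft, Algebra.TensorProduct.lift_tmul, AlgHom.comp_apply,
      AlgHom.comp_apply]
    generalize Δ a = u
    generalize Δ c = v
    induction u with
    | zero => simp
    | add x y hx hy => simp only [map_add, TensorProduct.add_tmul, add_mul, hx, hy]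
    | tmul p q =>
    induction v with
    | zero => simp
    | add x y hx hy => simp only [map_add, TensorProduct.tmul_add, mul_add, hx, hy]
    | tmul r s =>
      simp [incl12, incl32, incl23, triple_tmul, dualDistrib_comul]
      ring

theorem dualDistrib_cycleRight (Δ : A →ₐ[K] A ⊗[K] A) (φ ψ χ : Dual K A) (u : A ⊗[K] A) :
    dualDistrib K A A (TensorProduct.map (leftTr (op Δ) φ) (leftTr (op Δ) ψ) (comul χ)) u
      = triple (φ ⊗ₜ (ψ ⊗ₜ χ)) (cycleRight Δ u) := by
  induction u with
  | zero => simp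
  | add x y hx hy => simp only [map_add, hx, hy]
  | tmul a c =>
    rw [dualDistrib_leftTr_leftTr, cycleRight, Algebra.TensorProduct.lift_tmul, AlgHom.comp_apply,
      AlgHom.comp_apply]
    generalize Δ a = u
    generalize Δ c = v
    induction u with
    | zero => simp
    | add x y hx hy => simp only [map_add, TensorProduct.add_tmul, add_mul, hx, hy]
    | tmul p q =>
    induction v with
    | zero => simp
    | add x y hx hy => simp only [map_add, TensorProduct.tmul_add, mul_add, hx, hy]
    | tmul r s =>
      simp [incl13, incl23, triple_tmul, dualDistrib_comul, mul_assoc]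

/-- The operation dual to `Δ` is a cycle coalgebra as soon as `Δ(a)₁₂ Δ(c)₃₂` and `Δ(a)₁₃ Δ(b)₂₃`
agree after `Δ`, and `Δ` has an inverse `H` relative to the second factor. -/
theorem isCycleCoalgebra_op (Δ H : A →ₐ[K] A ⊗[K] A)
    (hcycle : (cycleLeft Δ).comp Δ = (cycleRight Δ).comp Δ)
    (hH : (extendRight H).comp Δ = Algebra.TensorProduct.includeLeft)
    (hΔ : (extendRight Δ).comp H = Algebra.TensorProduct.includeLeft) :
    IsCycleCoalgebra (op Δ) := by
  have inv : ∀ Δ H : A →ₐ[K] A ⊗[K] A,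
      (extendRight H).comp Δ = Algebra.TensorProduct.includeLeft → ∀ a b : Dual K A,
      op Δ (TensorProduct.map (leftTr (op H) a) LinearMap.id (comul b)) = counit b • a := by
    intro Δ H hH a b
    ext z
    rw [op_apply, dualDistrib_leftTr_id, ← AlgHom.comp_apply, hH]
    simp [counit, mul_comm]
  have cyc : ∀ a b c : Dual K A,
      op Δ (TensorProduct.map (leftTr (op Δ) a) (leftTr (op Δ) c) (comul b))
      = op Δ (TensorProduct.map (leftTr (op Δ) a) (leftTr (op Δ) b) (comulOp (K := K) c)) := by
    intro a b c
    ext z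
    rw [comulOp_eq_comul, op_apply, op_apply, dualDistrib_cycleLeft, dualDistrib_cycleRight]
    exact congrArg _ (DFunLike.congr_fun hcycle z)
  -- By cocommutativity one inverse operation serves as both `a^b` and `a_b`; the three cycle
  -- conditions coincide because `𝔡 = 𝔭`.
  refine ⟨⟨op H, op H, fun a b => ⟨inv Δ H hH a b, inv H Δ hΔ a b, ?_, ?_⟩⟩, cyc, cyc, cyc⟩
  · rw [comulOp_eq_comul]; exact inv H Δ hΔ a b
  · rw [comulOp_eq_comul]; exact inv Δ H hH a b

end DualCoalgebra


/-! ### Formal evolution equations `W' = h D(W)`. -/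

namespace PowerSeries

section Flow

variable {K R : Type*} [Field K] [CommRing R] [Algebra K R]

/-- The coefficientwise action of a derivation on power series. -/
def coeffDerivation (D : Derivation K R R) : Derivation K R⟦X⟧ R⟦X⟧ :=
  Derivation.mk'
    { toFun := fun W => mk fun v => D (coeff v W)
      map_add' := fun U V => by ext v; simp
      map_smul' := fun c U => by ext v; simp }
    fun U V => by
      ext v
      simp only [LinearMap.coe_mk, AddHom.coe_mk, coeff_mk, coeff_mul, map_sum, Derivation.leibniz,
        smul_eq_mul, map_add, Finset.sum_add_distrib]
      congr 1
      rw [← Finset.Nat.sum_antidiagonal_swap]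
      rfl

@[simp] theorem coeff_coeffDerivation (D : Derivation K R R) (W : R⟦X⟧) (v : ℕ) :
    coeff v (coeffDerivation D W) = D (coeff v W) := by
  simp [coeffDerivation]

@[simp] theorem coeffDerivation_C (D : Derivation K R R) (r : R) :
    coeffDerivation D (C r) = C (D r) := by
  ext v
  simp only [coeff_coeffDerivation, coeff_C]
  split_ifs <;> simp

/-- The derivation `W ↦ W' - h D(W)` of `R⟦X⟧`, whose kernel consists of the solutions of the
evolution equation `W' = h D(W)`. -/
def flowDefect (D : Derivation K R R) (h : R⟦X⟧) : Derivation K R⟦X⟧ R⟦X⟧ :=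
  (derivative R).restrictScalars K - h • coeffDerivation D

theorem flowDefect_apply (D : Derivation K R R) (h W : R⟦X⟧) :
    flowDefect D h W = derivative R W - h * coeffDerivation D W := rfl

theorem coeff_flowDefect (D : Derivation K R R) (h W : R⟦X⟧) (v : ℕ) :
    coeff v (flowDefect D h W) = coeff (v + 1) W * (v + 1)
      - ∑ ij ∈ Finset.HasAntidiagonal.antidiagonal v, coeff ij.1 h * D (coeff ij.2 W) := by
  simp [flowDefect_apply, coeff_derivative, coeff_mul]

/-- The coefficients of the solution of `W' = h D(W)` with constant coefficient `r`. -/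
def flowCoeff (K : Type*) {R : Type*} [Field K] [CommRing R] [Algebra K R] (D : R → R)
    (h : R⟦X⟧) (r : R) : ℕ → R
  | 0 => r
  | v + 1 => algebraMap K R ((v + 1 : K)⁻¹) *
      ∑ i : Fin (v + 1), coeff (v - i) h * D (flowCoeff K D h r i)

/-- The solution of `W' = h D(W)` with constant coefficient `r`. -/
def flow (K : Type*) {R : Type*} [Field K] [CommRing R] [Algebra K R] (D : R → R)
    (h : R⟦X⟧) (r : R) : R⟦X⟧ := mk (flowCoeff K D h r)

@[simp] theorem coeff_zero_flow (D : R → R) (h : R⟦X⟧) (r : R) :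
    coeff 0 (flow K D h r) = r := by
  rw [flow, coeff_mk, flowCoeff]

theorem flowDefect_C_mul (D : Derivation K R R) (h E : R⟦X⟧) (s : R)
    (hE : coeffDerivation D E = 0) :
    flowDefect D h (C s * E) = C s * derivative R E - h * C (D s) * E := by
  rw [flowDefect_apply, Derivation.leibniz, Derivation.leibniz, hE, derivative_C,
    coeffDerivation_C]
  simp only [smul_eq_mul, mul_zero, zero_add, add_zero]
  ring

variable [CharZero K]

theorem algebraMap_inv_mul_add_one (v : ℕ) :
    algebraMap K R ((v + 1 : K)⁻¹) * ((v : R) + 1) = 1 := by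
  have h1 : ((v : R) + 1) = algebraMap K R (v + 1) := by simp
  rw [h1, ← map_mul, inv_mul_cancel₀ (Nat.cast_add_one_ne_zero v), map_one]

/-- `D` may be any map, so that `D = id` also covers the scalar equation `W' = h W`. -/
theorem derivative_flow (D : R → R) (h : R⟦X⟧) (r : R) :
    derivative R (flow K D h r) = h * mk fun v => D (coeff v (flow K D h r)) := by
  ext v
  rw [coeff_mul, coeff_derivative, ← Finset.Nat.sum_antidiagonal_swap]
  simp only [Prod.fst_swap, Prod.snd_swap]
  rw [Finset.Nat.sum_antidiagonal_eq_sum_range_succ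
    (fun i j => coeff j h * coeff i (mk fun v => D (coeff v (flow K D h r)))), Finset.sum_range]
  simp only [flow, coeff_mk]
  rw [flowCoeff, mul_right_comm, algebraMap_inv_mul_add_one, one_mul]

theorem flowDefect_flow (D : Derivation K R R) (h : R⟦X⟧) (r : R) :
    flowDefect D h (flow K D h r) = 0 := by
  rw [flowDefect_apply, derivative_flow, sub_eq_zero]
  rfl

/-- Solutions of `W' = h D(W)` modulo a `D`-stable ideal are determined by their constant
coefficient. -/
theorem coeff_mem_of_flowDefect (D : Derivation K R R) (h W : R⟦X⟧) (I : Ideal R)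
    (hI : ∀ r ∈ I, D r ∈ I) (h0 : coeff 0 W ∈ I) (hW : ∀ v, coeff v (flowDefect D h W) ∈ I)
    (v : ℕ) : coeff v W ∈ I := by
  induction v using Nat.strong_induction_on with
  | _ v ih =>
    rcases v with _ | v
    · exact h0
    · have h1 := hW v
      rw [coeff_flowDefect] at h1
      have h2 : ∑ ij ∈ Finset.HasAntidiagonal.antidiagonal v, coeff ij.1 h * D (coeff ij.2 W) ∈ I :=
        Ideal.sum_mem _ fun ij hij => Ideal.mul_mem_left _ _ (hI _ (ih _ (by
          have := Finset.HasAntidiagonal.mem_antidiagonal.1 hij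
          omega)))
      -- Modulo `I` the equation expresses `(v + 1)` times the next coefficient through earlier
      -- ones, and `v + 1` is invertible.
      have h3 := Ideal.mul_mem_left _ (algebraMap K R ((v + 1 : K)⁻¹)) (I.add_mem h1 h2)
      rwa [sub_add_cancel, mul_comm (coeff _ W), ← mul_assoc,
        algebraMap_inv_mul_add_one, one_mul] at h3

theorem flow_unique (D : Derivation K R R) (h U V : R⟦X⟧) (h0 : coeff 0 U = coeff 0 V)
    (hU : flowDefect D h U = 0) (hV : flowDefect D h V = 0) : U = V := by
  rw [← sub_eq_zero]
  ext v
  have := coeff_mem_of_flowDefect D h (U - V) ⊥ (by simp)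
    (by rw [map_sub, h0, sub_self]; exact zero_mem _) (by simp [hU, hV]) v
  simpa using this

end Flow

/-! ### The flow of a vector field `g d/dx` and its linearisation. -/

section Field

variable {K : Type*} [Field K] [CharZero K]

/-- The derivation `g d/dx` of `K⟦x⟧`. -/
def vectorField (g : K⟦X⟧) : Derivation K K⟦X⟧ K⟦X⟧ := g • derivative K

omit [CharZero K] in
theorem vectorField_apply (g r : K⟦X⟧) : vectorField g r = g * derivative K r := rfl

-- A vector field vanishing at the origin preserves each `(xⁿ)`, so these ideals are admissible in
-- `coeff_mem_of_flowDefect`.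
omit [CharZero K] in
theorem vectorField_mem_span (γ : K⟦X⟧) (n : ℕ) (r : K⟦X⟧)
    (hr : r ∈ Ideal.span {(X : K⟦X⟧) ^ n}) :
    vectorField (X * γ) r ∈ Ideal.span {(X : K⟦X⟧) ^ n} := by
  rw [Ideal.mem_span_singleton] at hr ⊢
  obtain ⟨s, rfl⟩ := hr
  rcases n with _ | n
  · simp
  · refine ⟨γ * (((n : K⟦X⟧) + 1) * s + X * derivative K s), ?_⟩
    rw [vectorField_apply, Derivation.leibniz, derivative_pow, derivative_X, smul_eq_mul,
      smul_eq_mul]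
    push_cast
    ring

/-- The logarithmic derivative `e' / e`, as a series in the outer variable of `K⟦x⟧⟦y⟧`. -/
def outerLogDeriv (e : K⟦X⟧) : K⟦X⟧⟦X⟧ := map C (derivative K e * e⁻¹)

/-- The series `G ∈ K⟦x⟧⟦y⟧` with `G(x,0) = x` and `e(y) G_y = g(x) e'(y) G_x`. -/
def flowSeries (g e : K⟦X⟧) : K⟦X⟧⟦X⟧ := flow K (vectorField g) (outerLogDeriv e) X

theorem flowDefect_flowSeries (g e : K⟦X⟧) :
    flowDefect (vectorField g) (outerLogDeriv e) (flowSeries g e) = 0 :=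
  flowDefect_flow _ _ _

omit [CharZero K] in
theorem derivative_map_C (e : K⟦X⟧) :
    derivative K⟦X⟧ (map (C (R := K)) e) = map C (derivative K e) := by
  ext v : 1
  simp [coeff_derivative]

omit [CharZero K] in
theorem flowDefect_C_mul_map (g e s : K⟦X⟧) (he : constantCoeff e = 1) :
    flowDefect (vectorField g) (outerLogDeriv e) (C s * map C e)
      = C (s - g * derivative K s) * map C (derivative K e) := by
  have h1 : e⁻¹ * e = 1 := PowerSeries.inv_mul_cancel e (by simp [he])
  have h2 : map (C (R := K)) e⁻¹ * map C e = 1 := by rw [← map_mul, h1, map_one]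
  have h3 : coeffDerivation (vectorField g) (map (C (R := K)) e) = 0 := by
    ext v : 1
    simp [vectorField_apply]
  rw [flowDefect_C_mul _ _ _ _ h3, derivative_map_C, vectorField_apply, outerLogDeriv]
  simp only [map_mul, map_sub]
  linear_combination (-C g * C (derivative K s) * map C (derivative K e)) * h2

/-- `flowDefect` is a derivation, so `Gⁿ` solves the same equation, with initial value `xⁿ`. This is
what makes `y ↦ G` well defined on `K[y]/(yⁿ)`. -/
theorem X_pow_dvd_coeff_flowSeries_pow (γ e : K⟦X⟧) (n v : ℕ) :
    X ^ n ∣ coeff v (flowSeries (X * γ) e ^ n) := by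
  rw [← Ideal.mem_span_singleton]
  refine coeff_mem_of_flowDefect (vectorField (X * γ)) (outerLogDeriv e) _ _
    (vectorField_mem_span γ n) ?_ ?_ v
  · rw [coeff_zero_eq_constantCoeff_apply, map_pow, ← coeff_zero_eq_constantCoeff_apply,
      flowSeries, coeff_zero_flow]
    exact Ideal.mem_span_singleton_self _
  · simp [Derivation.leibniz_pow, flowDefect_flowSeries]

/-- Since `x γ ≡ x` modulo `x²`, the series `x e(y)` solves the flow equation modulo `x²` with the
same initial value as `G`. -/
theorem coeff_one_coeff_flowSeries (γ e : K⟦X⟧) (hγ : constantCoeff γ = 1)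
    (he : constantCoeff e = 1) (v : ℕ) :
    coeff 1 (coeff v (flowSeries (X * γ) e)) = coeff v e := by
  have h : coeff v (flowSeries (X * γ) e - C X * map C e) ∈ Ideal.span {(X : K⟦X⟧) ^ 2} := by
    obtain ⟨δ, hδ⟩ : X ∣ γ - 1 := by rw [X_dvd_iff]; simp [hγ]
    refine coeff_mem_of_flowDefect (vectorField (X * γ)) (outerLogDeriv e) _ _
      (vectorField_mem_span γ 2) ?_ (fun w => ?_) v
    · rw [map_sub, flowSeries, coeff_zero_flow, coeff_C_mul, coeff_map,
        coeff_zero_eq_constantCoeff_apply, he, map_one, mul_one, sub_self]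
      exact zero_mem _
    · rw [map_sub, flowDefect_flowSeries, flowDefect_C_mul_map _ _ _ he, derivative_X, zero_sub,
        map_neg, coeff_C_mul, Ideal.mem_span_singleton]
      have h2 : X ^ 2 ∣ X - X * γ * 1 := ⟨-δ, by linear_combination (-X : K⟦X⟧) * hδ⟩
      exact (h2.mul_right _).neg_right
  rw [Ideal.mem_span_singleton, X_pow_dvd_iff] at h
  have h1 := h 1 (by norm_num)
  rw [map_sub, coeff_C_mul, map_sub, sub_eq_zero, coeff_map] at h1
  rw [h1, mul_comm, coeff_C_mul, coeff_one_X, mul_one]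

/-- If `θ` is an eigenvector of `g d/dx` for the eigenvalue `1`, then `θ(G(x,y)) = θ(x) e(y)`. -/
theorem X_pow_dvd_coeff_aeval_flowSeries (γ e θ : K⟦X⟧) (he : constantCoeff e = 1)
    (hθ : X * γ * derivative K θ = θ) (n v : ℕ) :
    X ^ n ∣ coeff v (Polynomial.aeval (flowSeries (X * γ) e) (trunc n θ) - C θ * map C e) := by
  rw [← Ideal.mem_span_singleton]
  refine coeff_mem_of_flowDefect (vectorField (X * γ)) (outerLogDeriv e) _ _
    (vectorField_mem_span γ n) ?_ (fun w => ?_) v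
  -- At `y = 0` the series `G` is `x`, so the composite is `trunc n θ`, which is `θ` modulo `xⁿ`.
  · have h1 : coeff 0 (Polynomial.aeval (flowSeries (X * γ) e) (trunc n θ))
        = (trunc n θ : K⟦X⟧) := by
      have h2 : (coeff 0 (flowSeries (X * γ) e)) = X := coeff_zero_flow _ _ _
      rw [coeff_zero_eq_constantCoeff_apply] at h2 ⊢
      rw [Polynomial.aeval_def, Polynomial.hom_eval₂, h2]
      rw [← Polynomial.eval₂_C_X_eq_coe]
      rfl
    rw [map_sub, h1, coeff_C_mul, coeff_map, coeff_zero_eq_constantCoeff_apply, he, map_one,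
      mul_one, Ideal.mem_span_singleton, X_pow_dvd_iff]
    intro m hm
    rw [map_sub, coeff_coe_trunc_of_lt hm, sub_self]
  -- The chain rule kills the defect of the first term; that of `θ(x) e(y)` is a multiple of `θ - g
  -- θ' = 0`.
  · rw [map_sub, Derivation.map_aeval, flowDefect_flowSeries, flowDefect_C_mul_map _ _ _ he, hθ]
    simp

/-- Eigenvectors of `x γ d/dx` with eigenvalue `m` are determined by their coefficient at `x^m`. -/
theorem eq_zero_of_vectorField_eq (γ W : K⟦X⟧) (m : ℕ) (hγ : constantCoeff γ = 1)
    (hW : X * γ * derivative K W = (m : K⟦X⟧) * W) (hm : coeff m W = 0) : W = 0 := by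
  by_contra hne
  have hord := (exists_coeff_ne_zero_iff_ne_zero (φ := W)).2 hne
  classical
  -- `k` is the order of `W`. Comparing lowest terms gives `k = m`, against the vanishing of the
  -- coefficient at `x^m`.
  set k := Nat.find hord with hk
  have h1 : coeff k W ≠ 0 := Nat.find_spec hord
  have hdvd : X ^ k ∣ W := by
    rw [X_pow_dvd_iff]
    intro j hj
    have := Nat.find_min hord hj
    push Not at this
    exact this
  obtain ⟨s, hs⟩ := hdvd
  have h2 : coeff k W = constantCoeff s := by
    rw [hs, coeff_X_pow_mul', if_pos le_rfl]; simp
  have h3 := congrArg (coeff k) hW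
  have h4 : X * γ * derivative K W = X ^ k * (γ * ((k : K⟦X⟧) * s + X * derivative K s)) := by
    rw [hs, Derivation.leibniz, derivative_pow, derivative_X, smul_eq_mul, smul_eq_mul]
    rcases k with _ | k
    · simp; ring
    · push_cast
      ring
  have h5 : (m : K⟦X⟧) * W = X ^ k * ((m : K⟦X⟧) * s) := by rw [hs]; ring
  rw [h4, h5, coeff_X_pow_mul', coeff_X_pow_mul', if_pos le_rfl, if_pos le_rfl] at h3
  simp only [Nat.sub_self, coeff_zero_eq_constantCoeff, map_mul, map_add, constantCoeff_X,
    zero_mul, add_zero, hγ, one_mul, map_natCast] at h3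
  rw [h2] at h1
  have h6 := mul_right_cancel₀ h1 h3
  have h7 : k = m := by exact_mod_cast h6
  rw [← h2, h7] at h1
  exact h1 hm

/-- A normalised eigenvector of `x γ d/dx` with eigenvalue `1`. -/
theorem exists_eigenvector (γ : K⟦X⟧) (hγ : constantCoeff γ = 1) :
    ∃ s : K⟦X⟧, constantCoeff s = 1 ∧ X * γ * derivative K (X * s) = X * s := by
  have hinv : γ * γ⁻¹ = 1 := PowerSeries.mul_inv_cancel γ (by simp [hγ])
  obtain ⟨δ, hδ⟩ : X ∣ 1 - γ := by rw [X_dvd_iff]; simp [hγ]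
  -- For `θ = x s` the eigenvector equation reads `γ (s + x s') = s`; with `1 - γ = x δ` this
  -- becomes `s' = δ γ⁻¹ s`.
  obtain ⟨s, hs0, hs⟩ : ∃ s : K⟦X⟧, constantCoeff s = 1 ∧ derivative K s = δ * γ⁻¹ * s := by
    refine ⟨flow K id (δ * γ⁻¹) 1, ?_, ?_⟩
    · rw [← coeff_zero_eq_constantCoeff_apply, coeff_zero_flow]
    · rw [derivative_flow]
      congr 1
      ext v
      simp
  refine ⟨s, hs0, ?_⟩
  rw [Derivation.leibniz, derivative_X, smul_eq_mul, smul_eq_mul, hs]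
  linear_combination X * X * s * δ * hinv - X * s * hδ

end Field
end PowerSeries

/-! ### The series `g`, `G` and the coordinate `θ` attached to `f`. -/

namespace PowerSeries

variable {K : Type*} [Field K]

/-- Collecting the `G_y` terms gives `f(y) G_y = g(x) f'(y) G_x`, and `f(y)` is a unit. -/
theorem derivative_eq_iff_flowDefect_eq_zero (f g : K⟦X⟧) (G : K⟦X⟧⟦X⟧)
    (hf : constantCoeff f = 1) :
    derivative K⟦X⟧ G = C g * map (C (R := K)) (derivative K f) *
        mk (fun v => derivative K (coeff v G)) - map (C (R := K)) (f - 1) * derivative K⟦X⟧ G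
      ↔ flowDefect (vectorField g) (outerLogDeriv f) G = 0 := by
  have h1 : map (C (R := K)) f * map C f⁻¹ = 1 := by
    rw [← map_mul, PowerSeries.mul_inv_cancel f (by simp [hf]), map_one]
  have h2 : coeffDerivation (vectorField g) G = C g * mk (fun v => derivative K (coeff v G)) := by
    ext v : 1
    rw [coeff_coeffDerivation, coeff_C_mul, coeff_mk, vectorField_apply]
  rw [flowDefect_apply, h2, outerLogDeriv, map_mul, map_sub, map_one]
  constructor <;> intro h
  · linear_combination (map C f⁻¹) * h - derivative K⟦X⟧ G * h1
  · linear_combination (map C f) * h + map C (derivative K f) * C g *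
      mk (fun v => derivative K (coeff v G)) * h1

/-- The recursion for `𝔭ᵤᵥʷ` is multiplication by `G`, reflecting `Δ(y^w) = Δ(y)^w`. -/
theorem sccCoeff_eq_coeff_pow (G : K⟦X⟧⟦X⟧) (w u v : ℕ) :
    sccCoeff G w u v = coeff u (coeff v (G ^ w)) := by
  induction w using Nat.strong_induction_on generalizing u v with
  | _ w ih =>
    rcases w with _ | _ | w
    · rw [sccCoeff, pow_zero, coeff_one]
      rcases eq_or_ne v 0 with rfl | hv
      · simp [coeff_one]
      · simp [hv]
    · rw [sccCoeff, zero_add, pow_one]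
    · rw [sccCoeff, pow_succ' G (w + 1), coeff_mul, map_sum, Finset.sum_comm]
      refine Finset.sum_congr rfl fun b _ => ?_
      rw [coeff_mul]
      exact Finset.sum_congr rfl fun a _ => by rw [ih (w + 1) (by omega)]

variable [CharZero K]

/-- Cancelling `f'` determines `g`, and then `G` is the flow with initial value `x`. -/
theorem IsSCCPair.unique {m : ℕ} {f g g' : K⟦X⟧} {G G' : K⟦X⟧⟦X⟧} (hf : constantCoeff f = 1)
    (hf' : derivative K f ≠ 0) (h : IsSCCPair m f g G) (h' : IsSCCPair m f g' G') : G = G' := by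
  have hg : g = g' := mul_right_cancel₀ hf' (h.g_eq.trans h'.g_eq.symm)
  subst hg
  exact flow_unique (vectorField g) (outerLogDeriv f) G G' (h.G_zero.trans h'.G_zero.symm)
    ((derivative_eq_iff_flowDefect_eq_zero f g G hf).1 h.G_eq)
    ((derivative_eq_iff_flowDefect_eq_zero f g G' hf).1 h'.G_eq)

theorem isSCCPair_flowSeries {m : ℕ} {f g : K⟦X⟧} (hf : constantCoeff f = 1)
    (hg : g * derivative K f = f * (f ^ m - 1)) : IsSCCPair m f g (flowSeries g f) :=
  ⟨hg, coeff_zero_flow _ _ _,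
    (derivative_eq_iff_flowDefect_eq_zero f g _ hf).2 (flowDefect_flowSeries g f)⟩

omit [CharZero K] in
theorem derivative_one_add_X_pow_mul (m : ℕ) (hm : 1 ≤ m) (w : K⟦X⟧) :
    derivative K (1 + X ^ m * w) = X ^ (m - 1) * ((m : K⟦X⟧) * w + X * derivative K w) := by
  obtain ⟨m, rfl⟩ := Nat.exists_eq_add_of_le' hm
  rw [map_add, Derivation.leibniz, derivative_pow, derivative_X, Derivation.map_one_eq_zero,
    smul_eq_mul, smul_eq_mul]
  push_cast
  ring

theorem derivative_one_add_X_pow_mul_ne_zero (m : ℕ) (hm : 1 ≤ m) (w : K⟦X⟧)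
    (hw : constantCoeff w = 1) : derivative K (1 + X ^ m * w) ≠ 0 := by
  rw [derivative_one_add_X_pow_mul m hm]
  refine mul_ne_zero (pow_ne_zero _ X_ne_zero) fun h => ?_
  have := congrArg constantCoeff h
  simp [hw] at this
  omega

/-- For `f = 1 + x^m + ⋯` the vector field `g d/dx` with `g f' = f (f^m - 1)` is linearised by a
coordinate `θ = x + ⋯` satisfying `f^m (1 - m θ^m) = 1`. -/
theorem exists_linearisation (m : ℕ) (hm : 1 ≤ m) (f w : K⟦X⟧) (hf : f = 1 + X ^ m * w)
    (hw : constantCoeff w = 1) :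
    ∃ γ s : K⟦X⟧, constantCoeff γ = 1 ∧ constantCoeff s = 1 ∧
      X * γ * derivative K f = f * (f ^ m - 1) ∧ X * γ * derivative K (X * s) = X * s ∧
      f ^ m * (1 - (m : K⟦X⟧) * (X * s) ^ m) = 1 := by
  have hm0 : (m : K) ≠ 0 := by exact_mod_cast (by omega : m ≠ 0)
  have hf0 : constantCoeff f = 1 := by
    simp [hf, zero_pow (by omega : m ≠ 0)]
  set u : K⟦X⟧ := (m : K⟦X⟧) * w + X * derivative K w with hu
  set σ : K⟦X⟧ := ∑ i ∈ Finset.range m, f ^ i with hσ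
  have hu0 : constantCoeff u = m := by simp [hu, hw]
  have hσ0 : constantCoeff σ = m := by simp [hσ, hf0]
  have huinv : u * u⁻¹ = 1 := PowerSeries.mul_inv_cancel u (by rwa [hu0])
  have hX : (X : K⟦X⟧) * X ^ (m - 1) = X ^ m := by rw [← pow_succ', Nat.sub_add_cancel hm]
  have hfm : f ^ m - 1 = X ^ m * w * σ := by
    rw [← geom_sum_mul, ← hσ, hf]; ring
  have hf' : derivative K f = X ^ (m - 1) * u := by rw [hf, derivative_one_add_X_pow_mul m hm]
  -- Here `f^m - 1 = x^m w σ` and `f' = x^(m-1) u`, so `g` is `x` times `f w σ u⁻¹`; the constant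
  -- terms `m` of `σ` and `u` cancel.
  have hγ : constantCoeff (f * w * σ * u⁻¹) = 1 := by
    rw [map_mul, map_mul, map_mul, hf0, hw, hσ0, constantCoeff_inv, hu0, one_mul, one_mul,
      mul_inv_cancel₀ hm0]
  have hg : X * (f * w * σ * u⁻¹) * derivative K f = f * (f ^ m - 1) := by
    rw [hfm, hf', ← hX]
    linear_combination X * f * w * σ * X ^ (m - 1) * huinv
  obtain ⟨s, hs0, hs⟩ := exists_eigenvector (f * w * σ * u⁻¹) hγ
  refine ⟨_, s, hγ, hs0, hg, hs, ?_⟩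
  generalize f * w * σ * u⁻¹ = γ at hγ hg hs
  have hFf : f * f⁻¹ = 1 := PowerSeries.mul_inv_cancel f (by simp [hf0])
  have hF0 : constantCoeff f⁻¹ = 1 := by simp [hf0]
  generalize f⁻¹ = F at hFf hF0
  have hFm : f ^ m * F ^ m = 1 := by rw [← mul_pow, hFf, one_pow]
  -- With `F = f⁻¹`, both `1 - F^m` and `m θ^m` are eigenvectors of eigenvalue `m` with coefficient
  -- `m` at `x^m`.
  have hW : (1 - F ^ m - (m : K⟦X⟧) * (X * s) ^ m) = 0 := by
    refine eq_zero_of_vectorField_eq γ _ m hγ ?_ ?_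
    · have h1 : X * γ * derivative K F = - F * (f ^ m - 1) := by
        have h2 : derivative K (f * F) = 0 := by rw [hFf, Derivation.map_one_eq_zero]
        rw [Derivation.leibniz, smul_eq_mul, smul_eq_mul] at h2
        linear_combination F * X * γ * h2 - F * F * hg
          + (-X * γ * derivative K F - (f ^ m - 1) * F) * hFf
      have h3 : ∀ V : K⟦X⟧, derivative K (V ^ m) = (m : K⟦X⟧) * V ^ (m - 1) * derivative K V :=
        fun V => derivative_pow V m
      have h4 : ∀ V : K⟦X⟧, V ^ (m - 1) * V = V ^ m := fun V => by
        rw [← pow_succ, Nat.sub_add_cancel hm]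
      have h5 : derivative K ((m : K⟦X⟧) * (X * s) ^ m)
          = (m : K⟦X⟧) * derivative K ((X * s) ^ m) := by
        rw [← nsmul_eq_mul, map_nsmul, nsmul_eq_mul]
      rw [map_sub, map_sub, Derivation.map_one_eq_zero, h5, h3, h3]
      linear_combination (-(m : K⟦X⟧) * F ^ (m - 1)) * h1 + (m : K⟦X⟧) * (f ^ m - 1) * h4 F
        - (m : K⟦X⟧) * m * (X * s) ^ (m - 1) * hs - (m : K⟦X⟧) * m * h4 (X * s)
        + (m : K⟦X⟧) * hFm
    · have h1 : 1 - F ^ m - (m : K⟦X⟧) * (X * s) ^ m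
          = X ^ m * (F ^ m * w * σ - (m : K⟦X⟧) * s ^ m) := by
        linear_combination F ^ m * hfm - hFm
      rw [h1, coeff_X_pow_mul', if_pos le_rfl]
      simp [hF0, hw, hσ0, hs0]
  linear_combination hFm + f ^ m * hW

end PowerSeries

/-! ### Truncation of series to `A` and `A ⊗ A`. -/

namespace PowerSeries

variable {R B : Type*} [CommRing R] [CommRing B]

theorem eval₂_trunc_coe (φ : R →+* B) (b : B) (n : ℕ) (hb : b ^ n = 0) (P : Polynomial R) :
    (trunc n (P : R⟦X⟧)).eval₂ φ b = P.eval₂ φ b := by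
  obtain ⟨Q, hQ⟩ : Polynomial.X ^ n ∣ P - trunc n (P : R⟦X⟧) := by
    rw [Polynomial.X_pow_dvd_iff]
    intro d hd
    simp [coeff_trunc, hd]
  have h := congrArg (Polynomial.eval₂ φ b) hQ
  rw [Polynomial.eval₂_sub, Polynomial.eval₂_mul, Polynomial.eval₂_X_pow, hb, zero_mul,
    sub_eq_zero] at h
  exact h.symm

/-- Evaluation of power series at an element whose `n`-th power vanishes. -/
def evalNilpotent (φ : R →+* B) (b : B) (n : ℕ) (hb : b ^ n = 0) : R⟦X⟧ →+* B where
  toFun W := (trunc n W).eval₂ φ b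
  map_one' := by
    have := eval₂_trunc_coe φ b n hb 1
    rwa [Polynomial.coe_one, Polynomial.eval₂_one] at this
  -- The truncation of a product and the product of truncations differ by a multiple of `xⁿ`, which
  -- evaluates to `0`.
  map_mul' U V := by
    rw [← Polynomial.eval₂_mul, ← eval₂_trunc_coe φ b n hb (trunc n U * trunc n V),
      Polynomial.coe_mul, trunc_trunc_mul_trunc]
  map_zero' := by simp
  map_add' U V := by rw [map_add, Polynomial.eval₂_add]

theorem evalNilpotent_coe (φ : R →+* B) (b : B) (n : ℕ) (hb : b ^ n = 0) (P : Polynomial R) :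
    evalNilpotent φ b n hb P = P.eval₂ φ b :=
  eval₂_trunc_coe φ b n hb P

theorem evalNilpotent_eq_sum (φ : R →+* B) (b : B) (n : ℕ) (hb : b ^ n = 0) (W : R⟦X⟧) :
    evalNilpotent φ b n hb W = ∑ v ∈ Finset.range n, φ (coeff v W) * b ^ v :=
  eval₂_trunc_eq_sum_range b φ n W

theorem evalNilpotent_C (φ : R →+* B) (b : B) (n : ℕ) (hb : b ^ n = 0) (r : R) :
    evalNilpotent φ b n hb (C r) = φ r := by
  rw [← Polynomial.coe_C, evalNilpotent_coe, Polynomial.eval₂_C]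

theorem evalNilpotent_X (φ : R →+* B) (b : B) (n : ℕ) (hb : b ^ n = 0) :
    evalNilpotent φ b n hb X = b := by
  rw [← Polynomial.coe_X, evalNilpotent_coe, Polynomial.eval₂_X]

end PowerSeries

namespace TruncAlg

open PowerSeries

variable (K : Type*) [Field K] (n : ℕ)

/-- The class `y` in `K[y]/(yⁿ)`. -/
def root : TruncAlg K n := AdjoinRoot.root ((Polynomial.X : Polynomial K) ^ n)

theorem root_pow : root K n ^ n = 0 := by
  have h := AdjoinRoot.eval₂_root ((Polynomial.X : Polynomial K) ^ n)
  rwa [Polynomial.eval₂_X_pow] at h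

/-- The truncation `K⟦x⟧ → K[y]/(yⁿ)`. -/
def ofSeries : K⟦X⟧ →+* TruncAlg K n :=
  evalNilpotent (algebraMap K (TruncAlg K n)) (root K n) n (root_pow K n)

/-- The truncation `K⟦x⟧⟦y⟧ → K[y]/(yⁿ) ⊗ K[y]/(yⁿ)`. -/
def ofSeries₂ : K⟦X⟧⟦X⟧ →+* TruncAlg K n ⊗[K] TruncAlg K n :=
  evalNilpotent ((Algebra.TensorProduct.includeLeft (R := K) (S := K) (A := TruncAlg K n)
      (B := TruncAlg K n)).toRingHom.comp (ofSeries K n))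
    (1 ⊗ₜ root K n) n (by
      rw [Algebra.TensorProduct.tmul_pow, root_pow, TensorProduct.tmul_zero])

variable {K n}

theorem ofSeries_eq_mk (r : K⟦X⟧) : ofSeries K n r = AdjoinRoot.mk _ (trunc n r) := by
  rw [← AdjoinRoot.aeval_eq]
  rfl

theorem ofSeries_eq_sum (r : K⟦X⟧) :
    ofSeries K n r = ∑ i : Fin n, coeff (i : ℕ) r • basis K n i := by
  rw [ofSeries, evalNilpotent_eq_sum, Finset.sum_range]
  exact Finset.sum_congr rfl fun i _ => by rw [basis_apply, Algebra.smul_def, root]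

theorem ofSeries₂_eq_sum (W : K⟦X⟧⟦X⟧) :
    ofSeries₂ K n W = ∑ v : Fin n, ofSeries K n (coeff (v : ℕ) W) ⊗ₜ[K] basis K n v := by
  rw [ofSeries₂, evalNilpotent_eq_sum, Finset.sum_range]
  refine Finset.sum_congr rfl fun i _ => ?_
  rw [basis_apply, Algebra.TensorProduct.tmul_pow, one_pow]
  change (ofSeries K n _ ⊗ₜ[K] 1) * _ = _
  rw [Algebra.TensorProduct.tmul_mul_tmul, mul_one, one_mul, root]

theorem ofSeries₂_C (r : K⟦X⟧) : ofSeries₂ K n (C r) = ofSeries K n r ⊗ₜ 1 := by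
  rw [ofSeries₂, evalNilpotent_C]
  rfl

theorem ofSeries₂_map_C (e : K⟦X⟧) : ofSeries₂ K n (map C e) = 1 ⊗ₜ ofSeries K n e := by
  rw [ofSeries₂_eq_sum, ofSeries_eq_sum, TensorProduct.tmul_sum]
  refine Finset.sum_congr rfl fun i _ => ?_
  rw [coeff_map, ofSeries, evalNilpotent_C, Algebra.algebraMap_eq_smul_one,
    TensorProduct.smul_tmul]

theorem ofSeries_eq_zero_of_dvd {r : K⟦X⟧} (h : X ^ n ∣ r) : ofSeries K n r = 0 := by
  obtain ⟨s, rfl⟩ := h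
  rw [map_mul, map_pow, ofSeries, evalNilpotent_X, root_pow, zero_mul]

theorem ofSeries₂_eq_zero_of_dvd {W : K⟦X⟧⟦X⟧} (h : ∀ v, X ^ n ∣ coeff v W) :
    ofSeries₂ K n W = 0 := by
  rw [ofSeries₂_eq_sum]
  exact Finset.sum_eq_zero fun i _ => by
    rw [ofSeries_eq_zero_of_dvd (h i), TensorProduct.zero_tmul]

theorem isNilpotent_ofSeries {r : K⟦X⟧} (h : constantCoeff r = 0) :
    IsNilpotent (ofSeries K n r) := by
  refine ⟨n, ?_⟩
  rw [← map_pow]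
  exact ofSeries_eq_zero_of_dvd (pow_dvd_pow_of_dvd (X_dvd_iff.2 h) n)

theorem ofSeries₂_aeval (G : K⟦X⟧⟦X⟧) (P : Polynomial K) :
    ofSeries₂ K n (Polynomial.aeval G P) = Polynomial.aeval (ofSeries₂ K n G) P := by
  rw [Polynomial.aeval_def, Polynomial.aeval_def, Polynomial.hom_eval₂]
  congr 1
  ext c
  rw [RingHom.comp_apply, PowerSeries.algebraMap_apply, PowerSeries.algebraMap_apply, ofSeries₂_C,
    ofSeries, evalNilpotent_C]
  rfl

/-- The algebra morphism `K[y]/(yⁿ) → K[y]/(yⁿ) ⊗ K[y]/(yⁿ)` sending `y` to the truncation of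
`G(x,y)`. -/
def coop (G : K⟦X⟧⟦X⟧) (hG : ∀ v, X ^ n ∣ coeff v (G ^ n)) :
    TruncAlg K n →ₐ[K] TruncAlg K n ⊗[K] TruncAlg K n :=
  AdjoinRoot.liftAlgHom _ (Algebra.ofId K _) (ofSeries₂ K n G) (by
    rw [Polynomial.eval₂_X_pow, ← map_pow]
    exact ofSeries₂_eq_zero_of_dvd hG)

theorem coop_mk (G : K⟦X⟧⟦X⟧) (hG : ∀ v, X ^ n ∣ coeff v (G ^ n)) (P : Polynomial K) :
    coop G hG (AdjoinRoot.mk _ P) = ofSeries₂ K n (Polynomial.aeval G P) := by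
  rw [ofSeries₂_aeval]
  exact AdjoinRoot.liftAlgHom_mk (R := K) ..

theorem structCoeff_op_coop (G : K⟦X⟧⟦X⟧) (hG : ∀ v, X ^ n ∣ coeff v (G ^ n)) (i j k : Fin n) :
    structCoeff (DualCoalgebra.op (coop G hG)) i j k = sccCoeff G k i j := by
  have hb : basis K n k = AdjoinRoot.mk _ (Polynomial.X ^ (k : ℕ)) := by
    rw [basis_apply, map_pow, AdjoinRoot.mk_X]
  rw [structCoeff, TruncDual.basis, Module.Basis.dualBasis_repr, DualCoalgebra.op_apply, hb,
    coop_mk, map_pow, Polynomial.aeval_X, ofSeries₂_eq_sum, map_sum, sccCoeff_eq_coeff_pow]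
  have h : ∀ r : K⟦X⟧, (basis K n).dualBasis i (ofSeries K n r) = coeff (i : ℕ) r := by
    intro r
    rw [ofSeries_eq_sum, map_sum]
    simp [Finsupp.single_apply]
  simp only [TensorProduct.dualDistrib_apply, h, Module.Basis.dualBasis_apply_self]
  simp

/-- Algebra morphisms out of `K[y]/(yⁿ)` are determined by their value at any `y + y² c`. -/
theorem algHom_ext_of_coordinate {B : Type*} [CommRing B] [Algebra K B]
    {α β : TruncAlg K n →ₐ[K] B} (c : TruncAlg K n)
    (h : α (root K n + root K n ^ 2 * c) = β (root K n + root K n ^ 2 * c)) : α = β := by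
  refine AdjoinRoot.algHom_ext ?_
  change α (root K n) = β (root K n)
  obtain ⟨P, hP⟩ := AdjoinRoot.mk_surjective c
  have hα : IsNilpotent (α (root K n)) := ⟨n, by rw [← map_pow, root_pow, map_zero]⟩
  have hβ : IsNilpotent (β (root K n)) := ⟨n, by rw [← map_pow, root_pow, map_zero]⟩
  have hc : ∀ α : TruncAlg K n →ₐ[K] B,
      α c = (P.map (algebraMap K B)).eval (α (root K n)) := by
    intro α
    rw [← hP, ← AdjoinRoot.aeval_eq, ← Polynomial.aeval_algHom_apply, Polynomial.eval_map_algebraMap]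
    rfl
  obtain ⟨d, hd⟩ := Polynomial.sub_dvd_eval_sub (α (root K n)) (β (root K n))
    (P.map (algebraMap K B))
  rw [← hc, ← hc] at hd
  simp only [map_add, map_mul, map_pow] at h
  generalize α (root K n) = a at *
  generalize β (root K n) = b at *
  -- The hypothesis factors as `(a - b)` times this element, using `α c - β c = (a - b) d`; it is a
  -- unit because `a` and `b` are nilpotent.
  have hu : IsUnit (1 + ((a + b) * α c + b ^ 2 * d)) := by
    refine IsNilpotent.isUnit_one_add ?_
    refine Commute.isNilpotent_add (Commute.all _ _) ?_ ?_
    · exact (Commute.all _ _).isNilpotent_mul_right ((Commute.all _ _).isNilpotent_add hα hβ)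
    · rw [pow_two, mul_assoc]
      exact (Commute.all _ _).isNilpotent_mul_right hβ
  rw [← sub_eq_zero, ← hu.mul_left_eq_zero]
  linear_combination h - b ^ 2 * hd

/-- The truncated form of `θ(G(x,y)) = θ(x) e(y)`: in the coordinate `θ` the morphism is diagonal.
-/
theorem coop_flowSeries_ofSeries [CharZero K] (γ e θ : K⟦X⟧) (he : constantCoeff e = 1)
    (hθ : X * γ * derivative K θ = θ)
    (hG : ∀ v, X ^ n ∣ coeff v (flowSeries (X * γ) e ^ n)) :
    coop (flowSeries (X * γ) e) hG (ofSeries K n θ) = ofSeries K n θ ⊗ₜ ofSeries K n e := by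
  have h := ofSeries₂_eq_zero_of_dvd
    (X_pow_dvd_coeff_aeval_flowSeries γ e θ he hθ n)
  rw [map_sub, sub_eq_zero, map_mul, ofSeries₂_C, ofSeries₂_map_C,
    Algebra.TensorProduct.tmul_mul_tmul, mul_one, one_mul] at h
  rw [← h, ofSeries_eq_mk, coop_mk]

end TruncAlg

/-- In `a^m - b^m = (∑ aⁱ b^(m-1-i)) (a - b)` the sum is `m` modulo nilpotents, hence a unit. -/
theorem eq_of_pow_eq_of_isNilpotent {B : Type*} [CommRing B] (m : ℕ) (hm : IsUnit (m : B))
    {a b : B} (ha : IsNilpotent (a - 1)) (hb : IsNilpotent (b - 1)) (h : a ^ m = b ^ m) :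
    a = b := by
  have ha' : Ideal.Quotient.mk (nilradical B) a = 1 := by
    rw [← map_one (Ideal.Quotient.mk (nilradical B)), Ideal.Quotient.eq]; exact ha
  have hb' : Ideal.Quotient.mk (nilradical B) b = 1 := by
    rw [← map_one (Ideal.Quotient.mk (nilradical B)), Ideal.Quotient.eq]; exact hb
  have hσ : IsNilpotent (∑ i ∈ Finset.range m, a ^ i * b ^ (m - 1 - i) - (m : B)) := by
    rw [← mem_nilradical, ← Ideal.Quotient.eq]
    simp [ha', hb']
  have hu : IsUnit (∑ i ∈ Finset.range m, a ^ i * b ^ (m - 1 - i)) := by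
    have := hσ.isUnit_add_left_of_commute hm (Commute.all _ _)
    rwa [add_sub_cancel] at this
  rw [← sub_eq_zero, ← hu.mul_right_eq_zero, (Commute.all a b).geom_sum₂_mul, h, sub_self]


/-! ### The axioms checked on the linearising coordinate. -/

namespace DualCoalgebra

open TensorProduct

variable {K A : Type*} [Field K] [CharZero K] [CommRing A] [Algebra K A]

/-- If `Δ(θ) = θ ⊗ φ` and `φ^m (1 - m θ^m) = 1` with `φ` unipotent, then `(1 ⊗ φ) Δ(φ)` is
symmetric. -/
theorem comm_tmul_mul_apply (Δ : A →ₐ[K] A ⊗[K] A) (m : ℕ) (hm : m ≠ 0) (θ φ : A)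
    (hθ : Δ θ = θ ⊗ₜ φ) (hφ : φ ^ m * (1 - m * θ ^ m) = 1) (hnil : IsNilpotent (φ - 1)) :
    Algebra.TensorProduct.comm K A A (1 ⊗ₜ φ * Δ φ) = 1 ⊗ₜ φ * Δ φ := by
  have hu : IsUnit ((m : ℕ) : A ⊗[K] A) := by
    have h : IsUnit (m : K) := (Nat.cast_ne_zero.2 hm).isUnit
    simpa using h.map (algebraMap K (A ⊗[K] A))
  -- Applying `Δ` to the relation for `φ` gives `Δ(φ)^(-m) = 1 - m (θ ⊗ φ)^m`. Multiplying by `(1 ⊗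
  -- φ)^(-m) = 1 - m (1 ⊗ θ)^m` cancels `φ^m` and leaves a symmetric expression.
  have hE : (1 ⊗ₜ φ * Δ φ) ^ m *
      (1 - (m : A ⊗[K] A) * (θ ⊗ₜ[K] (1 : A)) ^ m
        - (m : A ⊗[K] A) * ((1 : A) ⊗ₜ[K] θ) ^ m) = 1 := by
    have h1 : Δ φ ^ m * (1 - (m : A ⊗[K] A) * (θ ⊗ₜ[K] (1 : A) * (1 : A) ⊗ₜ[K] φ) ^ m) = 1 := by
      rw [Algebra.TensorProduct.tmul_mul_tmul, mul_one, one_mul, ← hθ]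
      simpa using congrArg Δ hφ
    have h2 : ((1 : A) ⊗ₜ[K] φ) ^ m * (1 - (m : A ⊗[K] A) * ((1 : A) ⊗ₜ[K] θ) ^ m) = 1 := by
      have h := congrArg (Algebra.TensorProduct.includeRight (R := K) (A := A) (B := A)) hφ
      rwa [map_mul, map_sub, map_mul, map_pow, map_pow, map_natCast, map_one] at h
    rw [mul_pow] at h1
    rw [mul_pow]
    linear_combination h1 + Δ φ ^ m * h2
  have hE' : (Algebra.TensorProduct.comm K A A (1 ⊗ₜ φ * Δ φ)) ^ m *
      (1 - (m : A ⊗[K] A) * (θ ⊗ₜ[K] (1 : A)) ^ m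
        - (m : A ⊗[K] A) * ((1 : A) ⊗ₜ[K] θ) ^ m) = 1 := by
    have h := congrArg (Algebra.TensorProduct.comm K A A) hE
    simp only [map_mul, map_pow, map_sub, map_one, map_natCast,
      Algebra.TensorProduct.comm_tmul] at h ⊢
    linear_combination h
  have hS : IsNilpotent ((1 : A) ⊗ₜ[K] φ * Δ φ - 1) := by
    have h1 : IsNilpotent (Δ φ - 1) := by
      simpa using hnil.map Δ
    have h2 : IsNilpotent ((1 : A) ⊗ₜ[K] φ - 1) := by
      have h := hnil.map (Algebra.TensorProduct.includeRight (R := K) (A := A) (B := A))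
      rwa [map_sub, map_one] at h
    have h3 : (1 : A) ⊗ₜ[K] φ * Δ φ - 1 = 1 ⊗ₜ φ * (Δ φ - 1) + (1 ⊗ₜ φ - 1) := by ring
    rw [h3]
    exact (Commute.all _ _).isNilpotent_add ((Commute.all _ _).isNilpotent_mul_left h1) h2
  have hS' : IsNilpotent (Algebra.TensorProduct.comm K A A (1 ⊗ₜ φ * Δ φ) - 1) := by
    have := hS.map (Algebra.TensorProduct.comm K A A)
    rwa [map_sub, map_one] at this
  refine eq_of_pow_eq_of_isNilpotent m hu hS' hS ?_
  generalize (1 ⊗ₜ φ * Δ φ) = S at *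
  generalize Algebra.TensorProduct.comm K A A S = S' at *
  linear_combination S ^ m * hE' - S' ^ m * hE

-- The two sides are `θ₁ φ₂ Δ(φ)₃₂` and `θ₁ φ₃ Δ(φ)₂₃`, which differ by swapping the last two
-- factors of `(1 ⊗ φ) Δ(φ)`.
omit [CharZero K] in
theorem cycleLeft_eq_cycleRight (Δ : A →ₐ[K] A ⊗[K] A) (θ φ : A) (hθ : Δ θ = θ ⊗ₜ φ)
    (hS : Algebra.TensorProduct.comm K A A (1 ⊗ₜ φ * Δ φ) = 1 ⊗ₜ φ * Δ φ) :
    cycleLeft Δ (Δ θ) = cycleRight Δ (Δ θ) := by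
  have h1 : cycleLeft Δ (Δ θ) = θ ⊗ₜ 1 *
      incl23 (Algebra.TensorProduct.comm K A A (1 ⊗ₜ φ * Δ φ)) := by
    rw [hθ, cycleLeft, Algebra.TensorProduct.lift_tmul, AlgHom.comp_apply, hθ, map_mul, map_mul,
      ← mul_assoc]
    simp [incl12, incl32, incl23]
  have h2 : cycleRight Δ (Δ θ) = θ ⊗ₜ 1 * incl23 (1 ⊗ₜ φ * Δ φ) := by
    rw [hθ, cycleRight, Algebra.TensorProduct.lift_tmul, AlgHom.comp_apply, hθ, map_mul,
      ← mul_assoc]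
    simp [incl13, incl23]
  rw [h1, h2, hS]

omit [CharZero K] in
theorem extendRight_apply_eq (Δ H : A →ₐ[K] A ⊗[K] A) (θ φ ψ : A) (hΔ : Δ θ = θ ⊗ₜ φ)
    (hH : H θ = θ ⊗ₜ ψ) (h : φ * ψ = 1) : extendRight H (Δ θ) = θ ⊗ₜ 1 := by
  rw [hΔ, extendRight, Algebra.TensorProduct.lift_tmul, hH,
    Algebra.TensorProduct.includeRight_apply, Algebra.TensorProduct.tmul_mul_tmul, mul_one,
    mul_comm ψ, h]

end DualCoalgebra

/-! ### Existence and uniqueness of the standard cycle coalgebra. -/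

section Standard

open PowerSeries DualCoalgebra

variable {K : Type*} [Field K]

theorem sccSeries_eq (n v₀ : ℕ) (hv₀n : v₀ < n) (p : ℕ → K) (hp : p v₀ = 1) :
    ∃ w : K⟦X⟧, constantCoeff w = 1 ∧ sccSeries n v₀ p = 1 + X ^ v₀ * w := by
  refine ⟨∑ v ∈ Finset.Ico v₀ n, PowerSeries.C (p v) * X ^ (v - v₀), ?_, ?_⟩
  · rw [map_sum, Finset.sum_eq_single v₀]
    · simp [hp]
    · intro v hv hne
      have := Finset.mem_Ico.1 hv
      simp [zero_pow (by omega : v - v₀ ≠ 0)]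
    · simp [hv₀n]
  · rw [sccSeries, Finset.mul_sum]
    congr 1
    refine Finset.sum_congr rfl fun v hv => ?_
    have := Finset.mem_Ico.1 hv
    rw [mul_left_comm, ← pow_add, Nat.add_sub_cancel' this.1]

theorem coeff_sccSeries (n v₀ : ℕ) (p : ℕ → K) (v : ℕ) :
    coeff v (sccSeries n v₀ p)
      = (if v = 0 then 1 else 0) + if v₀ ≤ v ∧ v < n then p v else 0 := by
  rw [sccSeries, map_add, coeff_one, map_sum]
  simp [coeff_X_pow]

variable [CharZero K]

/-- The operation of the standard cycle coalgebra. -/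
theorem exists_standardCycleCoalgebra (n m : ℕ) (hn : 2 ≤ n) (hm : 1 ≤ m) (f w : K⟦X⟧)
    (hf : f = 1 + X ^ m * w) (hw : constantCoeff w = 1) :
    ∃ 𝔭 : TruncDual K n ⊗[K] TruncDual K n →ₗc[K] TruncDual K n, IsCycleCoalgebra 𝔭 ∧
      (∀ v : Fin n, structCoeff 𝔭 ⟨1, hn⟩ v ⟨1, hn⟩ = coeff (v : ℕ) f) ∧ IsSCC m f 𝔭 := by
  obtain ⟨γ, s, hγ, hs, hg, hθ, hfθ⟩ := exists_linearisation m hm f w hf hw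
  have hf0 : constantCoeff f = 1 := by simp [hf, zero_pow (by omega : m ≠ 0)]
  have hF0 : constantCoeff f⁻¹ = 1 := by simp [hf0]
  have hfF : f * f⁻¹ = 1 := PowerSeries.mul_inv_cancel f (by simp [hf0])
  have hG : ∀ e : K⟦X⟧, ∀ v, X ^ n ∣ coeff v (flowSeries (X * γ) e ^ n) :=
    fun e => X_pow_dvd_coeff_flowSeries_pow γ e n
  have hΔ := TruncAlg.coop_flowSeries_ofSeries γ f (X * s) hf0 hθ (hG f)
  have hH := TruncAlg.coop_flowSeries_ofSeries γ f⁻¹ (X * s) hF0 hθ (hG f⁻¹)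
  have hmul : TruncAlg.ofSeries K n f * TruncAlg.ofSeries K n f⁻¹ = 1 := by
    rw [← map_mul, hfF, map_one]
  obtain ⟨c, hc⟩ : ∃ c, TruncAlg.ofSeries K n (X * s)
      = TruncAlg.root K n + TruncAlg.root K n ^ 2 * c := by
    obtain ⟨r, hr⟩ : X ∣ s - 1 := by rw [X_dvd_iff]; simp [hs]
    refine ⟨TruncAlg.ofSeries K n r, ?_⟩
    have h1 : TruncAlg.ofSeries K n X = TruncAlg.root K n := evalNilpotent_X _ _ _ _
    rw [← h1, ← map_pow, ← map_mul, ← map_add]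
    congr 1
    linear_combination X * hr
  -- Since `θ = y + y² c` is a coordinate on `A`, each identity of algebra morphisms needs checking
  -- only at `θ`.
  have hext : ∀ {B : Type _} [CommRing B] [Algebra K B] {α β : TruncAlg K n →ₐ[K] B},
      α (TruncAlg.ofSeries K n (X * s)) = β (TruncAlg.ofSeries K n (X * s)) → α = β := by
    intro B _ _ α β h
    rw [hc] at h
    exact TruncAlg.algHom_ext_of_coordinate c h
  have hS := comm_tmul_mul_apply (TruncAlg.coop _ (hG f)) m (by omega) _ _ hΔ
    (by simpa using congrArg (TruncAlg.ofSeries K n) hfθ)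
    (by
      rw [← map_one (TruncAlg.ofSeries K n), ← map_sub]
      exact TruncAlg.isNilpotent_ofSeries (by simp [hf0]))
  refine ⟨op (TruncAlg.coop _ (hG f)), isCycleCoalgebra_op _ (TruncAlg.coop _ (hG f⁻¹))
    (hext ?_) (hext ?_) (hext ?_), fun v => ?_, ?_⟩
  · exact cycleLeft_eq_cycleRight _ _ _ hΔ hS
  · exact extendRight_apply_eq _ _ _ _ _ hΔ hH hmul
  · exact extendRight_apply_eq _ _ _ _ _ hH hΔ (by rw [mul_comm, hmul])
  · rw [TruncAlg.structCoeff_op_coop]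
    exact coeff_one_coeff_flowSeries γ f hγ hf0 v
  · exact ⟨X * γ, _, isSCCPair_flowSeries hf0 hg, TruncAlg.structCoeff_op_coop _ _⟩

theorem IsSCC.unique {n m : ℕ} (hm : 1 ≤ m) {f w : K⟦X⟧}
    (hf : f = 1 + X ^ m * w) (hw : constantCoeff w = 1)
    {𝔭 𝔮 : TruncDual K n ⊗[K] TruncDual K n →ₗc[K] TruncDual K n}
    (hp : IsSCC m f 𝔭) (hq : IsSCC m f 𝔮) : 𝔭 = 𝔮 := by
  obtain ⟨g, G, hG, h⟩ := hp
  obtain ⟨g', G', hG', h'⟩ := hq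
  have hf0 : constantCoeff f = 1 := by simp [hf, zero_pow (by omega : m ≠ 0)]
  have hGG : G = G' := IsSCCPair.unique hf0
    (hf ▸ derivative_one_add_X_pow_mul_ne_zero m hm w hw) hG hG'
  subst hGG
  have hlin : (𝔭 : TruncDual K n ⊗[K] TruncDual K n →ₗ[K] TruncDual K n) = 𝔮 := by
    refine ((TruncDual.basis K n).tensorProduct (TruncDual.basis K n)).ext fun ⟨i, j⟩ => ?_
    rw [Module.Basis.tensorProduct_apply]
    refine (TruncDual.basis K n).ext_elem fun k => ?_
    exact (h i j k).trans (h' i j k).symm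
  exact DFunLike.ext _ _ fun x => LinearMap.congr_fun hlin x

end Standard

end

theorem corollary3p3 {K : Type*} [Field K] [IsAlgClosed K] [CharZero K]
    (n v₀ : ℕ) (hn : 2 ≤ n) (hv₀ : 1 ≤ v₀) (hv₀n : v₀ < n)
    (p : ℕ → K) (hp : p v₀ = 1) :
    ∃ 𝔭 : TruncDual K n ⊗[K] TruncDual K n →ₗc[K] TruncDual K n,
      IsCycleCoalgebra 𝔭 ∧
      (∀ v : Fin n, (v : ℕ) < v₀ →
        structCoeff 𝔭 ⟨1, hn⟩ v ⟨1, hn⟩ = if (v : ℕ) = 0 then 1 else 0) ∧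
      (∀ v : Fin n, v₀ ≤ (v : ℕ) → structCoeff 𝔭 ⟨1, hn⟩ v ⟨1, hn⟩ = p v) ∧
      IsSCC v₀ (sccSeries n v₀ p) 𝔭 ∧
      ∀ 𝔮 : TruncDual K n ⊗[K] TruncDual K n →ₗc[K] TruncDual K n,
        IsSCC v₀ (sccSeries n v₀ p) 𝔮 → 𝔮 = 𝔭 := by
  obtain ⟨w, hw, hf⟩ := sccSeries_eq n v₀ hv₀n p hp
  obtain ⟨𝔭, hcycle, hcoeff, hscc⟩ := exists_standardCycleCoalgebra n v₀ hn hv₀ _ w hf hw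
  refine ⟨𝔭, hcycle, fun v hv => ?_, fun v hv => ?_, hscc,
    fun 𝔮 hq => IsSCC.unique hv₀ hf hw hq hscc⟩
  · rw [hcoeff, coeff_sccSeries, if_neg (by omega : ¬(v₀ ≤ (v : ℕ) ∧ (v : ℕ) < n)), add_zero]
  · rw [hcoeff, coeff_sccSeries, if_neg (by omega), if_pos ⟨hv, v.2⟩, zero_add]
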